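/- Let $R$ be a field of characteristic $0$ equipped with a derivation $\delta$, and assume $R$ is $\delta$-closed (differentially closed): for any differential polynomials $P,Q$ in one differential indeterminate with coefficients in $R$, with $Q\neq 0$ and $\operatorname{ord} Q<\operatorname{ord} P$ (elements of $R$ having order $-\infty$), there is $a\in R$ with $P(a)=0$ and $Q(a)\neq 0$. Let $R^\delta=\{c\in R:\delta c=0\}$ be the field of constants and let $n\ge 2$. A map $f:GL_n(R)\to\mathfrak{gl}_n(R)$ is a *$\delta$-map* if for some $r\ge 0$ each entry of $f(g)$ is a polynomial with coefficients in $R$ in the entries of $g$, in $\det(g)^{-1}$, and in the derivatives of these elements up to order $r$ (the polynomials not depending on $g$). A *classical $\delta$-cocycle* is a $\delta$-map $f:GL_n(R)\to\mathfrak{gl}_n(R)$ such that $$f(g_1g_2)=f(g_1)+g_1f(g_2)g_1^{-1}\qquad\text{for all } g_1,g_2\in GL_n(R).$$ It is *$\delta$-coherent* if for every algebraic subgroup $G\subset GL_n$ defined over $R^\delta$, with Lie algebra $L(G)\subset\mathfrak{gl}_n$, one has $f(G(R))\subset L(G)(R)$. **Theorem.** Let $f:GL_n(R)\to\mathfrak{gl}_n(R)$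 be a $\delta$-coherent classical $\delta$-cocycle. Then there exists $\nu\in R$ such that for all $g\in GL_n(R)$, $$f(g)=\nu\cdot\delta g\cdot g^{-1},$$ where $\delta g$ is obtained by applying $\delta$ to each entry of $g$. -/

import Mathlib

open scoped Differential MatrixGroups

namespace DeltaAlg

variable {R : Type*} [Field R] [Differential R]

/-- The value `P(a, δa, δ²a, …)` at `a` of a `δ`-polynomial `P(x, x', x'', …)` in one differential
indeterminate; the variable of index `k` stands for the `k`-th derivative of `x`. -/
noncomputable def evalDelta (P : MvPolynomial ℕ R) (a : R) : R :=
  MvPolynomial.eval (fun k : ℕ => (Differential.deriv : R → R)^[k] a) P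

/-- The order of a `δ`-polynomial in one differential indeterminate: the largest `k` such that the
`k`-th derivative of the indeterminate occurs in it, and `⊥` for an element of `R`. -/
noncomputable def deltaOrder (P : MvPolynomial ℕ R) : WithBot ℕ := P.vars.max

variable (R) in
/-- `R` is `δ`-closed (differentially closed, constrainedly closed), in Blum's form: for all
`δ`-polynomials `P`, `Q` in one differential indeterminate, `Q` nonzero and of order less than the
order of `P`, there is an `a` in `R` with `P(a) = 0` and `Q(a) ≠ 0`. -/
def IsDeltaClosed : Prop :=
  ∀ P Q : MvPolynomial ℕ R, Q ≠ 0 → deltaOrder Q < deltaOrder P →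
    ∃ a : R, evalDelta P a = 0 ∧ evalDelta Q a ≠ 0

variable (R) in
/-- The field of constants of `R`. -/
def constants : Subfield R where
  carrier := {c | c′ = 0}
  mul_mem' {a b} ha hb := by
    simp only [Set.mem_ofPred_eq] at *
    simp [Derivation.leibniz, ha, hb]
  one_mem' := by simp
  add_mem' {a b} ha hb := by
    simp only [Set.mem_ofPred_eq] at *
    simp [ha, hb]
  zero_mem' := by simp
  neg_mem' {a} ha := by
    simp only [Set.mem_ofPred_eq] at *
    simp [ha]
  inv_mem' a ha := by
    simp only [Set.mem_ofPred_eq] at *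
    simp [Derivation.leibniz_inv, ha]

/-- A `δ`-map between affine spaces: each coordinate of `Φ a` is a polynomial, with coefficients
in `R`, in the coordinates of `a, δa, …, δʳa`, for some order `r`. The variable of index `(k, i)`
stands for the `k`-th derivative of the `i`-th coordinate. -/
def IsDeltaMap {ι κ : Type*} (Φ : (ι → R) → (κ → R)) : Prop :=
  ∃ (r : ℕ) (F : κ → MvPolynomial (Fin (r + 1) × ι) R), ∀ (a : ι → R) (j : κ),
    Φ a j = MvPolynomial.eval
      (fun ki : Fin (r + 1) × ι => (Differential.deriv : R → R)^[(ki.1 : ℕ)] (a ki.2)) (F j)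

section GeneralLinear

variable {n : ℕ}

/-- The closed embedding of `GL_n` in affine space of dimension `n² + 1` given by the entries of
a matrix and the inverse of its determinant. -/
noncomputable def glEmbedding (g : GL (Fin n) R) : (Fin n × Fin n) ⊕ Unit → R
  | Sum.inl ij => (g : Matrix (Fin n) (Fin n) R) ij.1 ij.2
  | Sum.inr _ => (g : Matrix (Fin n) (Fin n) R).det⁻¹

/-- `f : GL_n(R) → gl_n(R)` is a `δ`-map: it is induced by a `δ`-map of the affine spaces in which
`GL_n` and `gl_n` are embedded as closed subvarieties. -/
def IsDeltaMapGL (f : GL (Fin n) R → Matrix (Fin n) (Fin n) R) : Prop :=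
  ∃ Φ : ((Fin n × Fin n) ⊕ Unit → R) → (Fin n × Fin n → R), IsDeltaMap Φ ∧
    ∀ (g : GL (Fin n) R) (i j : Fin n), f g i j = Φ (glEmbedding g) (i, j)

/-- A classical `δ`-cocycle of `GL_n` with values in `gl_n`: a `δ`-map which is a cocycle for the
adjoint action. -/
structure IsClassicalDeltaCocycle (f : GL (Fin n) R → Matrix (Fin n) (Fin n) R) : Prop where
  isDeltaMap : IsDeltaMapGL f
  cocycle : ∀ g₁ g₂ : GL (Fin n) R, f (g₁ * g₂) =
    f g₁ + (g₁ : Matrix (Fin n) (Fin n) R) * f g₂ * ((g₁⁻¹ : GL (Fin n) R) : Matrix _ _ R)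

/-- The subgroup `G` of `GL_n(R)` is (the group of points of) an algebraic subgroup defined over
the field of constants: it is the zero locus in `GL_n(R)` of a set of polynomials in the matrix
entries with constant coefficients. (Multiplying by powers of the determinant, it is no restriction
to use polynomials rather than all regular functions on `GL_n`.) -/
def IsAlgebraicOverConstants (G : Subgroup (GL (Fin n) R)) : Prop :=
  ∃ S : Set (MvPolynomial (Fin n × Fin n) (constants R)), ∀ g : GL (Fin n) R,
    g ∈ G ↔ ∀ p ∈ S, MvPolynomial.aeval
      (fun ij : Fin n × Fin n => (g : Matrix (Fin n) (Fin n) R) ij.1 ij.2) p = 0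

/-- The Lie algebra of an algebraic subgroup `G` of `GL_n`, as a subspace of `gl_n`: the tangent
space of `G` at the identity, that is, the matrices killed by the differentials at the identity of
all polynomials in the matrix entries that vanish on `G`. -/
noncomputable def lieAlg (G : Subgroup (GL (Fin n) R)) :
    Submodule R (Matrix (Fin n) (Fin n) R) where
  carrier := {A | ∀ p : MvPolynomial (Fin n × Fin n) R,
    (∀ g ∈ G, MvPolynomial.eval
      (fun ij : Fin n × Fin n => (g : Matrix (Fin n) (Fin n) R) ij.1 ij.2) p = 0) →
    ∑ ij : Fin n × Fin n, MvPolynomial.eval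
      (fun kl : Fin n × Fin n => (1 : Matrix (Fin n) (Fin n) R) kl.1 kl.2)
      (MvPolynomial.pderiv ij p) * A ij.1 ij.2 = 0}
  add_mem' {A B} hA hB p hp := by
    simp only [Matrix.add_apply, mul_add, Finset.sum_add_distrib]
    rw [hA p hp, hB p hp, add_zero]
  zero_mem' p _ := by simp
  smul_mem' c A hA p hp := by
    have h := congrArg (c * ·) (hA p hp)
    simpa [Finset.mul_sum, mul_left_comm] using h

/-- `f` is `δ`-coherent: it maps every algebraic subgroup of `GL_n` defined over the constants into
the Lie algebra of that subgroup. -/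
def IsDeltaCoherent (f : GL (Fin n) R → Matrix (Fin n) (Fin n) R) : Prop :=
  ∀ G : Subgroup (GL (Fin n) R), IsAlgebraicOverConstants G → ∀ g ∈ G, f g ∈ lieAlg G

/-- Kolchin's logarithmic derivative `g ↦ δg · g⁻¹`, where `δ` is applied to each entry. -/
noncomputable def logDeriv (g : GL (Fin n) R) : Matrix (Fin n) (Fin n) R :=
  (g : Matrix (Fin n) (Fin n) R).map (fun x => x′) * ((g⁻¹ : GL (Fin n) R) : Matrix _ _ R)

end GeneralLinear

end DeltaAlg

/-!
Coherence is needed only for the groups `{1 + x N}` with `N` a matrix of constants and `N² = ε N`.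
Such a group is cut out by linear equations, so its Lie algebra lies in the line `R N`
(`eq_smul_of_mem_lieAlg_lineSubgroup`), and the cocycle maps `1 + x N` to a multiple of `N`. In
particular `f(1 + x E_ij) = φ_ij(x) E_ij` for `i ≠ j`, and `f(1 + (t - 1) E_ii) = λ_i(t) E_ii`.

The cocycle identity applied to `1 + x E_ij` and `1 + y E_ij` shows that `φ_ij` is additive.
Conjugating `1 + x E_ij` by the dilations of the `i`-th and of the `j`-th coordinate gives
`φ_ij(tx) = t φ_ij(x) + λ_i(t) t x = t φ_ij(x) + λ_j(t) t x`. The torus attached to the idempotent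
`E_ii - E_ij` is conjugate to the dilations of the `i`-th coordinate by `1 + E_ij`, and this forces
`φ_ij(1) = 0` (`apply_transvectionGL_one`). Thus `λ_i = λ` does not depend on `i`, every `φ_ij` is
the map `t ↦ λ(t) t`, and this map is a derivation of the field `R`.

This derivation `D` is moreover given by a `δ`-polynomial, hence, being additive, by a linear
differential operator `∑ ν_k δᵏ`. Choose `b` with `δ²b = 0` and `δb ≠ 0`. Then
`D(ba) - b D(a) = ∑ k ν_k δb δᵏ⁻¹a` equals `D(b) a` for all `a`; as a nonzero linear operator does
not vanish identically on a `δ`-closed field, `ν_k = 0` for `k ≥ 2`, and `D(1) = 0` gives `ν_0 = 0`.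
So `D = ν δ` (`exists_eq_mul_deriv`). The cocycles `f` and `ν δg g⁻¹` agree on elementary matrices
and dilations, which generate `GL_n`.
-/

namespace DeltaAlg

section Field

variable {R : Type*} [Field R] {n : ℕ}

/-! ### Elementary matrices and dilations -/

/-- The elementary matrix `1 + x E_ij`, for `i ≠ j`, as an element of `GL_n`. -/
def transvectionGL {i j : Fin n} (hij : i ≠ j) (x : R) : GL (Fin n) R where
  val := 1 + x • Matrix.single i j 1
  inv := 1 - x • Matrix.single i j 1
  val_inv := by simp [add_mul, mul_sub, hij.symm]
  inv_val := by simp [sub_mul, mul_add, hij.symm]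

/-- The element `1 + (t - 1) N` of `GL_n`, for an idempotent matrix `N`: it is multiplication by
`t` on the range of `N` and the identity on its kernel. -/
def dilationGL {N : Matrix (Fin n) (Fin n) R} (hN : N * N = N) (t : Rˣ) : GL (Fin n) R where
  val := 1 + ((t : R) - 1) • N
  inv := 1 + (((t⁻¹ : Rˣ) : R) - 1) • N
  val_inv := by
    simp only [mul_add, add_mul, one_mul, mul_one, smul_mul_assoc, mul_smul_comm, hN]
    match_scalars <;> simp [sub_mul]
  inv_val := by
    simp only [mul_add, add_mul, one_mul, mul_one, smul_mul_assoc, mul_smul_comm, hN]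
    match_scalars <;> simp [sub_mul]

lemma single_mul_self (i : Fin n) :
    Matrix.single i i (1 : R) * Matrix.single i i 1 = Matrix.single i i 1 := by simp

lemma single_sub_single_mul_self {i j : Fin n} (hij : i ≠ j) :
    (Matrix.single i i (1 : R) - Matrix.single i j 1) *
      (Matrix.single i i 1 - Matrix.single i j 1) = Matrix.single i i 1 - Matrix.single i j 1 := by
  simp [sub_mul, mul_sub, hij.symm]

lemma val_transvectionGL {i j : Fin n} (hij : i ≠ j) (x : R) :
    (transvectionGL hij x : Matrix (Fin n) (Fin n) R) = 1 + x • Matrix.single i j 1 := rfl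

lemma val_inv_transvectionGL {i j : Fin n} (hij : i ≠ j) (x : R) :
    (((transvectionGL hij x)⁻¹ : GL (Fin n) R) : Matrix (Fin n) (Fin n) R) =
      1 - x • Matrix.single i j 1 := rfl

lemma val_dilationGL {N : Matrix (Fin n) (Fin n) R} (hN : N * N = N) (t : Rˣ) :
    (dilationGL hN t : Matrix (Fin n) (Fin n) R) = 1 + ((t : R) - 1) • N := rfl

lemma val_inv_dilationGL {N : Matrix (Fin n) (Fin n) R} (hN : N * N = N) (t : Rˣ) :
    (((dilationGL hN t)⁻¹ : GL (Fin n) R) : Matrix (Fin n) (Fin n) R) =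
      1 + (((t⁻¹ : Rˣ) : R) - 1) • N := rfl

/-- `GL_n` is generated by the elementary matrices and the dilations of single coordinates. -/
theorem eq_top_of_transvectionGL_mem_of_dilationGL_mem {H : Subgroup (GL (Fin n) R)}
    (hU : ∀ (i j : Fin n) (hij : i ≠ j) (x : R), transvectionGL hij x ∈ H)
    (hT : ∀ (i : Fin n) (t : Rˣ), dilationGL (single_mul_self i) t ∈ H) : H = ⊤ := by
  refine (Subgroup.eq_top_iff' H).2 fun g => ?_
  suffices h : ∃ k ∈ H, (k : Matrix (Fin n) (Fin n) R) = g by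
    obtain ⟨k, hk, e⟩ := h
    rwa [← Units.ext e]
  refine Matrix.diagonal_transvection_induction_of_det_ne_zero
    (fun M => ∃ k ∈ H, (k : Matrix (Fin n) (Fin n) R) = M) g ?_ ?_ ?_ ?_
  · exact Matrix.GeneralLinearGroup.det_ne_zero g
  · intro d hd
    rw [Matrix.det_diagonal, Finset.prod_ne_zero_iff] at hd
    suffices h : ∀ s : Finset (Fin n), ∃ k ∈ H,
        (k : Matrix (Fin n) (Fin n) R) = Matrix.diagonal fun a => if a ∈ s then d a else 1 by
      simpa using h Finset.univ
    intro s
    induction s using Finset.induction_on with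
    | empty => exact ⟨1, one_mem H, by simp⟩
    | insert a s ha ih =>
      obtain ⟨k, hk, e⟩ := ih
      refine ⟨_, H.mul_mem (hT a (Units.mk0 (d a) (hd a (Finset.mem_univ a)))) hk, ?_⟩
      rw [Units.val_mul, e, val_dilationGL, Units.val_mk0, ← Matrix.diagonal_single,
        ← Matrix.diagonal_one, ← Matrix.diagonal_smul, Matrix.diagonal_add,
        Matrix.diagonal_mul_diagonal]
      congr 1
      ext b
      rcases eq_or_ne b a with rfl | hb
      · simp [ha]
      · simp [hb]
  · rintro ⟨i, j, hij, c⟩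
    exact ⟨_, hU i j hij c, by
      simp [val_transvectionGL, Matrix.TransvectionStruct.toMatrix, Matrix.transvection]⟩
  · rintro A B - - ⟨k, hk, rfl⟩ ⟨l, hl, rfl⟩
    exact ⟨k * l, mul_mem hk hl, rfl⟩

/-! ### The groups of the matrices `1 + x N` -/

/-- The subgroup of the invertible matrices of the form `1 + x N`, where `N² = ε N`. -/
def lineSubgroup (N : Matrix (Fin n) (Fin n) R) (ε : R) (hN : N * N = ε • N) :
    Subgroup (GL (Fin n) R) where
  carrier := {g | ∃ x : R, (g : Matrix (Fin n) (Fin n) R) = 1 + x • N}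
  one_mem' := ⟨0, by simp⟩
  mul_mem' := by
    rintro g h ⟨x, hx⟩ ⟨y, hy⟩
    refine ⟨x + y + x * y * ε, ?_⟩
    rw [Units.val_mul, hx, hy]
    simp only [mul_add, add_mul, one_mul, mul_one, smul_mul_assoc, mul_smul_comm, hN]
    module
  inv_mem' := by
    rintro g ⟨x, hx⟩
    have hgN : (g : Matrix (Fin n) (Fin n) R) * N = (1 + x * ε) • N := by
      rw [hx, add_mul, one_mul, smul_mul_assoc, hN]
      module
    have hNg : N = (1 + x * ε) • (((g⁻¹ : GL (Fin n) R) : Matrix (Fin n) (Fin n) R) * N) := by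
      rw [← mul_smul_comm, ← hgN, ← mul_assoc, ← Units.val_mul]
      simp
    have hinv : ((g⁻¹ : GL (Fin n) R) : Matrix (Fin n) (Fin n) R) =
        1 - x • (((g⁻¹ : GL (Fin n) R) : Matrix (Fin n) (Fin n) R) * N) := by
      have : ((g⁻¹ : GL (Fin n) R) : Matrix (Fin n) (Fin n) R) * (1 + x • N) = 1 := by
        rw [← hx, ← Units.val_mul]; simp
      rw [mul_add, mul_one, mul_smul_comm] at this
      exact eq_sub_of_add_eq this
    -- If `1 + x ε = 0`, the identity `hNg` forces `N = 0`.
    by_cases h : 1 + x * ε = 0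
    · rw [h, zero_smul] at hNg
      exact ⟨0, by rw [hinv, hNg]; simp⟩
    · refine ⟨-(x * (1 + x * ε)⁻¹), ?_⟩
      rw [hinv]
      nth_rewrite 2 [hNg]
      rw [smul_smul, neg_mul, mul_assoc, inv_mul_cancel₀ h, mul_one, neg_smul, sub_eq_add_neg]

/-- Since `N a b = 1`, the scalar `x` in `g = 1 + x N` can be read off from the entry `(a, b)`, so that
the condition becomes a system of linear equations in the entries of `g`. -/
lemma eq_one_add_smul_iff {N : Matrix (Fin n) (Fin n) R} {a b : Fin n}
    (hab : N a b = 1) (g : Matrix (Fin n) (Fin n) R) :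
    (∃ x : R, g = 1 + x • N) ↔
      ∀ k l, g k l - (1 : Matrix (Fin n) (Fin n) R) k l -
        N k l * (g a b - (1 : Matrix (Fin n) (Fin n) R) a b) = 0 := by
  constructor
  · rintro ⟨x, rfl⟩ k l
    simp only [Matrix.add_apply, Matrix.smul_apply, smul_eq_mul, hab]
    ring
  · intro h
    refine ⟨g a b - (1 : Matrix (Fin n) (Fin n) R) a b, ?_⟩
    ext k l
    simp only [Matrix.add_apply, Matrix.smul_apply, smul_eq_mul]
    linear_combination h k l

/-- The Lie algebra of the group of the matrices `1 + x N` is contained in the line spanned by `N`: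
the linear equations of the group are also those of its tangent space. -/
lemma eq_smul_of_mem_lieAlg_lineSubgroup {N : Matrix (Fin n) (Fin n) R} {ε : R}
    (hN : N * N = ε • N) {a b : Fin n} (hab : N a b = 1) {A : Matrix (Fin n) (Fin n) R}
    (hA : A ∈ lieAlg (lineSubgroup N ε hN)) : A = A a b • N := by
  ext k l
  have h := hA (MvPolynomial.X (k, l) - MvPolynomial.C ((1 : Matrix (Fin n) (Fin n) R) k l) -
    MvPolynomial.C (N k l) *
      (MvPolynomial.X (a, b) - MvPolynomial.C ((1 : Matrix (Fin n) (Fin n) R) a b)))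
    (fun g hg => by simpa using (eq_one_add_smul_iff hab _).1 hg k l)
  have e : ∀ p : Fin n × Fin n, ∑ x : Fin n × Fin n, MvPolynomial.eval
      (fun kl : Fin n × Fin n => (1 : Matrix (Fin n) (Fin n) R) kl.1 kl.2)
      (MvPolynomial.pderiv x (MvPolynomial.X p)) * A x.1 x.2 = A p.1 p.2 := by
    intro p
    rw [Finset.sum_eq_single p]
    · simp
    · intro q _ hq
      rw [MvPolynomial.pderiv_X_of_ne hq.symm, map_zero, zero_mul]
    · simp
  simp only [map_sub, map_mul, MvPolynomial.pderiv_C, sub_zero, MvPolynomial.pderiv_C_mul, sub_mul,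
    Finset.sum_sub_distrib, MvPolynomial.eval_C, mul_assoc, ← Finset.mul_sum, e] at h
  rw [Matrix.smul_apply, smul_eq_mul, mul_comm]
  exact sub_eq_zero.1 h

end Field

variable {R : Type*} [Field R] [Differential R]

/-! ### Derivations given by `δ`-polynomials -/

/-- A linear differential operator that vanishes on the whole of a `δ`-closed field has zero
coefficients: otherwise it is an admissible `Q` in the definition of `δ`-closedness, and takes a
nonzero value. -/
lemma eq_zero_of_sum_mul_iterate_deriv_eq_zero (hR : IsDeltaClosed R) (μ : ℕ → R) (N : ℕ)
    (h : ∀ a : R, ∑ k ∈ Finset.range N, μ k * (Differential.deriv : R → R)^[k] a = 0)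
    (k : ℕ) (hk : k < N) : μ k = 0 := by
  classical
  by_contra hne
  set Q : MvPolynomial ℕ R :=
    ∑ k ∈ Finset.range N, MvPolynomial.C (μ k) * MvPolynomial.X k with hQ
  have hcoeff : Q.coeff (Finsupp.single k 1) = μ k := by
    simp [hQ, MvPolynomial.coeff_sum, MvPolynomial.coeff_C_mul, MvPolynomial.coeff_X,
      Finsupp.single_left_inj, hk]
  have hQ0 : Q ≠ 0 := by
    intro h0
    rw [h0] at hcoeff
    exact hne (by simpa using hcoeff.symm)
  have hvars : Q.vars ⊆ Finset.range N := by
    refine (MvPolynomial.vars_sum_subset _ _).trans ?_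
    intro j hj
    simp only [Finset.mem_biUnion] at hj
    obtain ⟨l, hl, hj⟩ := hj
    have := MvPolynomial.vars_mul _ _ hj
    simp at this
    simpa [this] using hl
  have hord : deltaOrder Q < deltaOrder (MvPolynomial.X N : MvPolynomial ℕ R) := by
    unfold deltaOrder
    rw [MvPolynomial.vars_X, Finset.max_singleton]
    rw [Finset.max_eq_sup_withBot, Finset.sup_lt_iff (WithBot.bot_lt_coe N)]
    intro j hj
    exact_mod_cast Finset.mem_range.1 (hvars hj)
  obtain ⟨a, -, ha⟩ := hR _ Q hQ0 hord
  apply ha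
  simpa [evalDelta, hQ] using h a

lemma exists_deriv_deriv_eq_zero (hR : IsDeltaClosed R) :
    ∃ b : R, b′ ≠ 0 ∧ b′′ = 0 := by
  obtain ⟨b, hb, hb'⟩ := hR (MvPolynomial.X 2) (MvPolynomial.X 1) (MvPolynomial.X_ne_zero 1)
    (by simp [deltaOrder, MvPolynomial.vars_X])
  exact ⟨b, by simpa [evalDelta] using hb', by simpa [evalDelta] using hb⟩

/-- Leibniz's rule for `δᵏ(ba)` has only two terms when `δ²b = 0`. -/
lemma iterate_deriv_mul_of_deriv_deriv_eq_zero {b : R} (hb : b′′ = 0) (k : ℕ) (a : R) :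
    (Differential.deriv : R → R)^[k] (b * a) = b * (Differential.deriv : R → R)^[k] a +
      k * b′ * (Differential.deriv : R → R)^[k - 1] a := by
  induction k with
  | zero => simp
  | succ k ih =>
    rw [Function.iterate_succ_apply', ih]
    rcases k with _ | k
    · simp [Derivation.leibniz, mul_comm]
    · simp only [Function.iterate_succ_apply', Derivation.leibniz, map_add, smul_eq_mul,
        Nat.add_sub_cancel, hb, Derivation.map_natCast]
      push_cast
      ring

/-- The constant term of `c ↦ P(c v)` does not depend on `v`, and its linear coefficient depends
linearly on `v`. -/
lemma exists_coeff_one_eq_linearCombination {K : Type*} [Field K] (P : MvPolynomial ℕ K) :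
    ∃ (c : K) (ν : ℕ →₀ K), ∀ v : ℕ → K,
      (MvPolynomial.aeval (fun k => Polynomial.X * Polynomial.C (v k)) P).coeff 0 = c ∧
      (MvPolynomial.aeval (fun k => Polynomial.X * Polynomial.C (v k)) P).coeff 1 =
        Finsupp.linearCombination K v ν := by
  induction P using MvPolynomial.induction_on with
  | C a => exact ⟨a, 0, fun v => by simp [Polynomial.algebraMap_eq, Polynomial.coeff_C]⟩
  | add p q hp hq =>
    obtain ⟨c, ν, h⟩ := hp
    obtain ⟨c', ν', h'⟩ := hq
    exact ⟨c + c', ν + ν', fun v => by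
      simp only [map_add, Polynomial.coeff_add, (h v).1, (h v).2, (h' v).1, (h' v).2, true_and]⟩
  | mul_X p k hp =>
    obtain ⟨c, ν, h⟩ := hp
    refine ⟨0, Finsupp.single k c, fun v => ?_⟩
    have e : MvPolynomial.aeval (fun k => Polynomial.X * Polynomial.C (v k))
        (p * MvPolynomial.X k) = MvPolynomial.aeval (fun k => Polynomial.X * Polynomial.C (v k)) p
          * Polynomial.C (v k) * Polynomial.X := by
      rw [map_mul, MvPolynomial.aeval_X]; ring
    rw [e]
    refine ⟨by simp, ?_⟩
    rw [Polynomial.coeff_mul_X, Polynomial.coeff_mul_C, (h v).1]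
    simp

/-- An additive map given by a `δ`-polynomial is a linear differential operator: by
`D(ma) = m D(a)` for all natural numbers `m`, the polynomial `P(c a, c δa, …)` in `c` equals `c D(a)`,
so only the linear part of `P` contributes to `D(a)`. -/
lemma exists_eq_sum_mul_iterate_deriv [CharZero R] (D : R →+ R) (P : MvPolynomial ℕ R)
    (hP : ∀ a, D a = evalDelta P a) :
    ∃ (N : ℕ) (ν : ℕ → R), ∀ a,
      D a = ∑ k ∈ Finset.range N, ν k * (Differential.deriv : R → R)^[k] a := by
  obtain ⟨c, ν, h⟩ := exists_coeff_one_eq_linearCombination P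
  refine ⟨ν.support.sup id + 1, ν, fun a => ?_⟩
  set v : ℕ → R := fun k => (Differential.deriv : R → R)^[k] a
  set q := MvPolynomial.aeval (fun k => Polynomial.X * Polynomial.C (v k)) P with hq
  -- Both sides agree at the natural numbers, which are infinitely many in characteristic zero.
  have hqe : q = Polynomial.X * Polynomial.C (D a) := by
    refine Polynomial.eq_of_infinite_eval_eq _ _
      ((Set.infinite_range_of_injective (Nat.cast_injective (R := R))).mono ?_)
    rintro _ ⟨m, rfl⟩
    have e1 : q.eval (m : R) = evalDelta P (m • a) := by
      rw [hq, MvPolynomial.aeval_def, ← Polynomial.coe_evalRingHom, MvPolynomial.hom_eval₂,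
        evalDelta, MvPolynomial.eval, MvPolynomial.coe_eval₂Hom]
      congr 1
      · ext; simp
      · ext k
        simp only [Polynomial.coe_evalRingHom, Polynomial.eval_mul, Polynomial.eval_X,
          Polynomial.eval_C, v]
        rw [← nsmul_eq_mul]
        exact (iterate_map_nsmul (Differential.deriv : Derivation ℤ R R) k a m).symm
    change q.eval (m : R) = _
    rw [e1, ← hP, map_nsmul, nsmul_eq_mul, Polynomial.eval_mul, Polynomial.eval_X,
      Polynomial.eval_C]
  have h1 := (h v).2
  rw [← hq, hqe, Finsupp.linearCombination_apply, Finsupp.sum] at h1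
  rw [show D a = (Polynomial.X * Polynomial.C (D a)).coeff 1 by simp, h1]
  simp only [smul_eq_mul]
  refine Finset.sum_subset (fun k hk => ?_) (fun k _ hk => ?_)
  · exact Finset.mem_range.2 (Nat.lt_succ_of_le (Finset.le_sup (f := id) hk))
  · simp [Finsupp.notMem_support_iff.1 hk]

/-- A derivation of a `δ`-closed field that is given by a `δ`-polynomial is a multiple of `δ`. -/
theorem exists_eq_mul_deriv [CharZero R] (hR : IsDeltaClosed R) (D : R →+ R)
    (hD : ∀ a b, D (a * b) = a * D b + D a * b) (P : MvPolynomial ℕ R)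
    (hP : ∀ a, D a = evalDelta P a) : ∃ ν : R, ∀ a, D a = ν * a′ := by
  obtain ⟨N, ν, hν⟩ := exists_eq_sum_mul_iterate_deriv D P hP
  obtain ⟨b, hb, hb2⟩ := exists_deriv_deriv_eq_zero hR
  have h1 : D 1 = 0 := by simpa using hD 1 1
  -- Commuting with multiplication by `b` lowers the order of the operator by one.
  have key : ∀ a, ∑ k ∈ Finset.range N, ν k * (k * b′ * (Differential.deriv : R → R)^[k - 1] a) =
      D b * a := by
    intro a
    have h := hD b a
    rw [hν (b * a), hν a, Finset.mul_sum] at h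
    have h2 : ∑ k ∈ Finset.range N, ν k * (Differential.deriv : R → R)^[k] (b * a) =
        ∑ k ∈ Finset.range N, b * (ν k * (Differential.deriv : R → R)^[k] a) +
        ∑ k ∈ Finset.range N, ν k * (k * b′ * (Differential.deriv : R → R)^[k - 1] a) := by
      rw [← Finset.sum_add_distrib]
      refine Finset.sum_congr rfl fun k _ => ?_
      rw [iterate_deriv_mul_of_deriv_deriv_eq_zero hb2]
      ring
    rw [h2] at h
    exact add_left_cancel h
  rcases N with _ | N
  · exact ⟨0, fun a => by simp [hν a]⟩
  have hz : ∀ k, 2 ≤ k → k < N + 1 → ν k = 0 := by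
    intro k hk2 hkN
    obtain ⟨j, rfl⟩ : ∃ j, k = j + 1 + 1 := ⟨k - 2, by omega⟩
    have := eq_zero_of_sum_mul_iterate_deriv_eq_zero hR
      (fun k => ν (k + 1) * ((k + 1 : ℕ) * b′) - if k = 0 then D b else 0) N (fun a => by
        have h := key a
        rw [Finset.sum_range_succ'] at h
        have hN : 0 < N := by omega
        simp only [sub_mul, Finset.sum_sub_distrib, ite_mul, zero_mul, Finset.sum_ite_eq',
          Finset.mem_range, hN, if_true, Function.iterate_zero, id_eq]
        rw [← h]
        simp [mul_assoc]) (j + 1) (by omega)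
    have hj : ((j + 1 + 1 : ℕ) : R) ≠ 0 := Nat.cast_ne_zero.2 (by omega)
    simpa [hb, hj, -Nat.cast_add] using this
  have hlow : ∀ a, D a = ν 0 * a + (if 1 < N + 1 then ν 1 else 0) * a′ := by
    intro a
    rw [hν a, Finset.sum_range_succ']
    rcases N with _ | N
    · simp
    · rw [Finset.sum_range_succ', Finset.sum_eq_zero]
      · simp [add_comm]
      · intro k hk
        rw [hz (k + 1 + 1) (by omega) (by simpa using hk), zero_mul]
  have h0 : ν 0 = 0 := by
    have := hlow 1
    rw [h1] at this
    simpa using this.symm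
  exact ⟨_, fun a => by rw [hlow a, h0, zero_mul, zero_add]⟩

variable {n : ℕ}

/-! ### Coherence for the groups of the matrices `1 + x N` -/

lemma one_mem_constants_apply (k l : Fin n) :
    (1 : Matrix (Fin n) (Fin n) R) k l ∈ constants R := by
  rw [Matrix.one_apply]
  split_ifs
  exacts [one_mem _, zero_mem _]

lemma single_mem_constants_apply (i j k l : Fin n) :
    Matrix.single i j (1 : R) k l ∈ constants R := by
  rw [Matrix.single_apply]
  split_ifs
  exacts [one_mem _, zero_mem _]

lemma lineSubgroup_isAlgebraic {N : Matrix (Fin n) (Fin n) R} {ε : R} (hN : N * N = ε • N)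
    (hc : ∀ k l, N k l ∈ constants R) {a b : Fin n} (hab : N a b = 1) :
    IsAlgebraicOverConstants (lineSubgroup N ε hN) := by
  refine ⟨Set.range fun kl : Fin n × Fin n =>
    MvPolynomial.X kl - MvPolynomial.C ⟨_, one_mem_constants_apply kl.1 kl.2⟩ -
      MvPolynomial.C ⟨_, hc kl.1 kl.2⟩ *
        (MvPolynomial.X (a, b) - MvPolynomial.C ⟨_, one_mem_constants_apply a b⟩), fun g => ?_⟩
  refine (eq_one_add_smul_iff hab _).trans ?_
  simp only [Set.forall_mem_range, Prod.forall, map_sub, map_mul, MvPolynomial.aeval_X,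
    MvPolynomial.aeval_C]
  rfl

/-- Coherence for the groups `lineSubgroup`, which is all that is used of the assumption. -/
lemma IsDeltaCoherent.exists_eq_smul {f : GL (Fin n) R → Matrix (Fin n) (Fin n) R}
    (hf : IsDeltaCoherent f) {N : Matrix (Fin n) (Fin n) R} {ε : R} (hN : N * N = ε • N)
    (hc : ∀ k l, N k l ∈ constants R) {a b : Fin n} (hab : N a b = 1) {g : GL (Fin n) R} {x : R}
    (hg : (g : Matrix (Fin n) (Fin n) R) = 1 + x • N) : ∃ y : R, f g = y • N :=
  ⟨_, eq_smul_of_mem_lieAlg_lineSubgroup hN hab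
    (hf _ (lineSubgroup_isAlgebraic hN hc hab) g ⟨x, hg⟩)⟩

variable {f : GL (Fin n) R → Matrix (Fin n) (Fin n) R}

/-! ### The cocycle on elementary matrices and dilations -/

lemma IsDeltaCoherent.apply_transvectionGL (hcoh : IsDeltaCoherent f) {i j : Fin n} (hij : i ≠ j)
    (x : R) : f (transvectionGL hij x) =
      f (transvectionGL hij x) i j • Matrix.single i j 1 := by
  obtain ⟨y, hy⟩ := hcoh.exists_eq_smul (N := Matrix.single i j 1) (ε := 0)
    (by simp [hij.symm]) (single_mem_constants_apply i j) (a := i) (b := j) (by simp)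
    (val_transvectionGL hij x)
  simp [hy]

lemma IsDeltaCoherent.apply_dilationGL_single (hcoh : IsDeltaCoherent f) (i : Fin n) (t : Rˣ) :
    f (dilationGL (single_mul_self i) t) =
      f (dilationGL (single_mul_self i) t) i i • Matrix.single i i 1 := by
  obtain ⟨y, hy⟩ := hcoh.exists_eq_smul (N := Matrix.single i i 1) (ε := 1)
    (by simp) (single_mem_constants_apply i i) (a := i) (b := i) (by simp)
    (val_dilationGL (single_mul_self i) t)
  simp [hy]

lemma IsDeltaCoherent.apply_dilationGL_single_sub_single (hcoh : IsDeltaCoherent f)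
    {i j : Fin n} (hij : i ≠ j) (t : Rˣ) : ∃ y : R,
    f (dilationGL (single_sub_single_mul_self hij) t) =
      y • (Matrix.single i i 1 - Matrix.single i j 1) :=
  hcoh.exists_eq_smul (N := Matrix.single i i 1 - Matrix.single i j 1) (ε := 1)
    (by rw [one_smul, single_sub_single_mul_self hij])
    (fun k l => sub_mem (single_mem_constants_apply i i k l) (single_mem_constants_apply i j k l))
    (a := i) (b := i) (by simp [hij.symm])
    (val_dilationGL (single_sub_single_mul_self hij) t)

/-- The cocycle identity compares the values at the conjugate elements `g` and `k = h g h⁻¹`. -/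
lemma IsClassicalDeltaCocycle.apply_of_mul_eq_mul (hf : IsClassicalDeltaCocycle f)
    {g h k : GL (Fin n) R}
    (e : (h : Matrix (Fin n) (Fin n) R) * (g : Matrix (Fin n) (Fin n) R) =
      (k : Matrix (Fin n) (Fin n) R) * (h : Matrix (Fin n) (Fin n) R)) :
    f h + (h : Matrix (Fin n) (Fin n) R) * f g * ((h⁻¹ : GL (Fin n) R) : Matrix _ _ R) =
      f k + (k : Matrix (Fin n) (Fin n) R) * f h * ((k⁻¹ : GL (Fin n) R) : Matrix _ _ R) := by
  rw [← hf.cocycle, ← hf.cocycle]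
  exact congrArg f (Units.ext e)

lemma apply_transvectionGL_add (hf : IsClassicalDeltaCocycle f) (hcoh : IsDeltaCoherent f)
    {i j : Fin n} (hij : i ≠ j) (x y : R) :
    f (transvectionGL hij (x + y)) i j =
      f (transvectionGL hij x) i j + f (transvectionGL hij y) i j := by
  have e : transvectionGL hij (x + y) = transvectionGL hij x * transvectionGL hij y := by
    apply Units.ext
    simp only [Units.val_mul, val_transvectionGL]
    simp [add_mul, mul_add, hij.symm, add_smul, add_assoc, add_left_comm, add_comm]
  rw [e, hf.cocycle, hcoh.apply_transvectionGL hij y, val_inv_transvectionGL, val_transvectionGL]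
  simp [add_mul, mul_sub, hij.symm]

/-- Conjugation of `1 + x E_ij` by the dilation of the `i`-th coordinate by `t`. -/
lemma apply_transvectionGL_mul_left (hf : IsClassicalDeltaCocycle f) (hcoh : IsDeltaCoherent f)
    {i j : Fin n} (hij : i ≠ j) (t : Rˣ) (x : R) :
    f (transvectionGL hij (t * x)) i j = t * f (transvectionGL hij x) i j +
      f (dilationGL (single_mul_self i) t) i i * (t * x) := by
  have h := hf.apply_of_mul_eq_mul (h := dilationGL (single_mul_self i) t)
    (g := transvectionGL hij x) (k := transvectionGL hij (t * x)) (by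
      simp only [val_transvectionGL, val_dilationGL]
      simp only [add_mul, mul_add, one_mul, mul_one, smul_mul_assoc, mul_smul_comm,
        Matrix.single_mul_single_same, Matrix.single_mul_single_of_ne _ _ _ _ hij.symm]
      module)
  rw [hcoh.apply_transvectionGL hij x, hcoh.apply_transvectionGL hij (t * x),
    hcoh.apply_dilationGL_single i t] at h
  simp only [val_transvectionGL, val_dilationGL, val_inv_transvectionGL, val_inv_dilationGL] at h
  have h' := congrFun (congrFun h i) j
  simp [add_mul, mul_add, mul_sub, hij, hij.symm] at h'
  linear_combination -h'

/-- Conjugation of `1 + t x E_ij` by the dilation of the `j`-th coordinate by `t`. -/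
lemma apply_transvectionGL_mul_right (hf : IsClassicalDeltaCocycle f) (hcoh : IsDeltaCoherent f)
    {i j : Fin n} (hij : i ≠ j) (t : Rˣ) (x : R) :
    f (transvectionGL hij (t * x)) i j = t * f (transvectionGL hij x) i j +
      f (dilationGL (single_mul_self j) t) j j * (t * x) := by
  have h := hf.apply_of_mul_eq_mul (h := dilationGL (single_mul_self j) t)
    (g := transvectionGL hij (t * x)) (k := transvectionGL hij x) (by
      simp only [val_transvectionGL, val_dilationGL]
      simp only [add_mul, mul_add, one_mul, mul_one, smul_mul_assoc, mul_smul_comm,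
        Matrix.single_mul_single_same, Matrix.single_mul_single_of_ne _ _ _ _ hij.symm]
      module)
  rw [hcoh.apply_transvectionGL hij x, hcoh.apply_transvectionGL hij (t * x),
    hcoh.apply_dilationGL_single j t] at h
  simp only [val_transvectionGL, val_dilationGL, val_inv_transvectionGL, val_inv_dilationGL] at h
  have h' := congrFun (congrFun h i) j
  simp [add_mul, mul_add, mul_sub, hij.symm] at h'
  have ht : (t : R) ≠ 0 := t.ne_zero
  field_simp at h'
  linear_combination h'

/-- Conjugating the dilation of the `i`-th coordinate by `1 + E_ij` gives the dilation attached to the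
idempotent `E_ii - E_ij`, which also has constant entries; coherence for the latter torus forces `f`
to vanish at `1 + E_ij`. -/
lemma apply_transvectionGL_one [CharZero R] (hf : IsClassicalDeltaCocycle f)
    (hcoh : IsDeltaCoherent f) {i j : Fin n} (hij : i ≠ j) :
    f (transvectionGL hij 1) i j = 0 := by
  -- Any `t ≠ 0, 1` works: the identity obtained is `(1 - t) φ_ij(1) = 0`.
  set t : Rˣ := Units.mk0 (2 : R) two_ne_zero with ht
  obtain ⟨y, hy⟩ := hcoh.apply_dilationGL_single_sub_single hij t
  have h := hf.apply_of_mul_eq_mul (h := transvectionGL hij 1)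
    (g := dilationGL (single_mul_self i) t)
    (k := dilationGL (single_sub_single_mul_self hij) t) (by
      simp only [val_transvectionGL, val_dilationGL]
      simp only [add_mul, mul_add, one_mul, mul_one, smul_mul_assoc, mul_smul_comm, sub_mul,
        Matrix.single_mul_single_same, Matrix.single_mul_single_of_ne _ _ _ _ hij.symm]
      module)
  rw [hcoh.apply_transvectionGL hij 1, hcoh.apply_dilationGL_single i t, hy] at h
  simp only [val_transvectionGL, val_dilationGL, val_inv_transvectionGL, val_inv_dilationGL] at h
  have h1 := congrFun (congrFun h i) i
  have h2 := congrFun (congrFun h i) j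
  simp [add_mul, mul_add, mul_sub, sub_mul, smul_sub, hij, hij.symm] at h1 h2
  have ht2 : (t : R) = 2 := rfl
  rw [ht2] at h2
  linear_combination -h2 - h1

lemma apply_transvectionGL_eq_mul [CharZero R] (hf : IsClassicalDeltaCocycle f)
    (hcoh : IsDeltaCoherent f) {i j : Fin n} (hij : i ≠ j) (t : Rˣ) :
    f (transvectionGL hij t) i j = f (dilationGL (single_mul_self i) t) i i * t := by
  have h := apply_transvectionGL_mul_left hf hcoh hij t 1
  rwa [apply_transvectionGL_one hf hcoh hij, mul_zero, zero_add, mul_one] at h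

/-- The value at the dilation by `t` of a coordinate does not depend on the coordinate. -/
lemma apply_dilationGL_single_eq (hf : IsClassicalDeltaCocycle f)
    (hcoh : IsDeltaCoherent f) (i j : Fin n) (t : Rˣ) :
    f (dilationGL (single_mul_self i) t) i i = f (dilationGL (single_mul_self j) t) j j := by
  rcases eq_or_ne i j with rfl | hij
  · rfl
  have h := (apply_transvectionGL_mul_left hf hcoh hij t 1).symm.trans
    (apply_transvectionGL_mul_right hf hcoh hij t 1)
  simpa using h

lemma exists_evalDelta_eq_apply_transvectionGL (hf : IsClassicalDeltaCocycle f)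
    {i j : Fin n} (hij : i ≠ j) :
    ∃ P : MvPolynomial ℕ R, ∀ x, f (transvectionGL hij x) i j = evalDelta P x := by
  obtain ⟨Φ, ⟨r, F, hF⟩, hΦ⟩ := hf.isDeltaMap
  -- Each coordinate of `glEmbedding (transvectionGL hij x)` is either constant in `x` or `x`.
  have key : ∀ (k : ℕ) (q : (Fin n × Fin n) ⊕ Unit), ∃ p : MvPolynomial ℕ R, ∀ x,
      (Differential.deriv : R → R)^[k] (glEmbedding (transvectionGL hij x) q) =
        evalDelta p x := by
    rintro k (⟨a, b⟩ | u)
    · by_cases hab : i = a ∧ j = b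
      · obtain ⟨rfl, rfl⟩ := hab
        exact ⟨MvPolynomial.X k, fun x => by
          simp [glEmbedding, val_transvectionGL, evalDelta, hij]⟩
      · exact ⟨MvPolynomial.C ((Differential.deriv : R → R)^[k]
          ((1 : Matrix (Fin n) (Fin n) R) a b)), fun x => by
            simp [glEmbedding, val_transvectionGL, evalDelta, hab]⟩
    · refine ⟨MvPolynomial.C ((Differential.deriv : R → R)^[k] 1), fun x => ?_⟩
      have : (transvectionGL hij x : Matrix (Fin n) (Fin n) R).det = 1 := by
        rw [val_transvectionGL, Matrix.smul_single, smul_eq_mul, mul_one]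
        exact Matrix.det_transvection_of_ne i j hij x
      simp [glEmbedding, this, evalDelta]
  choose p hp using key
  refine ⟨MvPolynomial.aeval (fun ki : Fin (r + 1) × ((Fin n × Fin n) ⊕ Unit) =>
    p ki.1 ki.2) (F (i, j)), fun x => ?_⟩
  rw [hΦ, hF]
  simp only [hp]
  rw [evalDelta, MvPolynomial.aeval_def, MvPolynomial.hom_eval₂, MvPolynomial.eval,
    MvPolynomial.coe_eval₂Hom]
  congr 1
  ext; simp

lemma exists_apply_transvectionGL_eq_mul_deriv [CharZero R] (hR : IsDeltaClosed R)
    (hf : IsClassicalDeltaCocycle f) (hcoh : IsDeltaCoherent f) {i j : Fin n} (hij : i ≠ j) :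
    ∃ ν : R, ∀ x, f (transvectionGL hij x) i j = ν * x′ := by
  obtain ⟨P, hP⟩ := exists_evalDelta_eq_apply_transvectionGL hf hij
  let D : R →+ R := AddMonoidHom.mk' (fun x => f (transvectionGL hij x) i j)
    (apply_transvectionGL_add hf hcoh hij)
  refine exists_eq_mul_deriv hR D (fun a b => ?_) P hP
  rcases eq_or_ne a 0 with rfl | ha
  · simp
  · have h := apply_transvectionGL_mul_left hf hcoh hij (Units.mk0 a ha) b
    have h' := apply_transvectionGL_eq_mul hf hcoh hij (Units.mk0 a ha)
    rw [Units.val_mk0] at h h'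
    change f (transvectionGL hij (a * b)) i j = a * f (transvectionGL hij b) i j +
      f (transvectionGL hij a) i j * b
    linear_combination h - b * h'

/-- The factor `ν` can be taken to be the same for all elementary matrices and dilations. -/
lemma exists_apply_eq_mul_deriv [CharZero R] (hR : IsDeltaClosed R) (hn : 2 ≤ n)
    (hf : IsClassicalDeltaCocycle f) (hcoh : IsDeltaCoherent f) :
    ∃ ν : R, (∀ (i : Fin n) (t : Rˣ),
      f (dilationGL (single_mul_self i) t) i i * t = ν * (t : R)′) ∧
      ∀ (i j : Fin n) (hij : i ≠ j) (x : R), f (transvectionGL hij x) i j = ν * x′ := by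
  have h01 : (⟨0, by omega⟩ : Fin n) ≠ ⟨1, by omega⟩ := by simp
  obtain ⟨ν, hν⟩ := exists_apply_transvectionGL_eq_mul_deriv hR hf hcoh h01
  have hdil : ∀ (i : Fin n) (t : Rˣ),
      f (dilationGL (single_mul_self i) t) i i * t = ν * (t : R)′ := fun i t => by
    rw [apply_dilationGL_single_eq hf hcoh i ⟨0, by omega⟩,
      ← apply_transvectionGL_eq_mul hf hcoh h01, hν]
  refine ⟨ν, hdil, fun i j hij x => ?_⟩
  rcases eq_or_ne x 0 with rfl | hx
  · simpa using apply_transvectionGL_add hf hcoh hij 0 0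
  · exact (apply_transvectionGL_eq_mul hf hcoh hij (Units.mk0 x hx)).trans
      (hdil i (Units.mk0 x hx))

/-! ### The logarithmic derivative -/

lemma map_deriv_one_add_smul {N : Matrix (Fin n) (Fin n) R} (hN : ∀ k l, N k l ∈ constants R)
    (x : R) : (1 + x • N).map (fun y => y′) = x′ • N := by
  ext k l
  have h1 : ((1 : Matrix (Fin n) (Fin n) R) k l)′ = 0 := one_mem_constants_apply k l
  have h2 : (N k l)′ = 0 := hN k l
  simp [Derivation.leibniz, h1, h2, mul_comm]

lemma map_deriv_mul (A B : Matrix (Fin n) (Fin n) R) :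
    (A * B).map (fun y => y′) = A.map (fun y => y′) * B + A * B.map (fun y => y′) := by
  ext k l
  simp only [Matrix.map_apply, Matrix.mul_apply, Matrix.add_apply, map_sum, Derivation.leibniz,
    smul_eq_mul, ← Finset.sum_add_distrib]
  exact Finset.sum_congr rfl fun m _ => by ring

lemma logDeriv_mul (g h : GL (Fin n) R) : logDeriv (g * h) = logDeriv g +
    (g : Matrix (Fin n) (Fin n) R) * logDeriv h * ((g⁻¹ : GL (Fin n) R) : Matrix _ _ R) := by
  have hh : (h : Matrix (Fin n) (Fin n) R) * ((h⁻¹ : GL (Fin n) R) : Matrix _ _ R) = 1 := by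
    rw [← Units.val_mul, mul_inv_cancel, Units.val_one]
  simp only [logDeriv]
  rw [mul_inv_rev, Units.val_mul, Units.val_mul, map_deriv_mul, add_mul]
  congr 1
  · rw [← mul_assoc, mul_assoc _ (h : Matrix (Fin n) (Fin n) R), hh, mul_one]
  · simp only [mul_assoc]

lemma logDeriv_transvectionGL {i j : Fin n} (hij : i ≠ j) (x : R) :
    logDeriv (transvectionGL hij x) = x′ • Matrix.single i j 1 := by
  rw [logDeriv, val_transvectionGL, val_inv_transvectionGL,
    map_deriv_one_add_smul (single_mem_constants_apply i j)]
  simp [mul_sub, hij.symm]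

lemma logDeriv_dilationGL_single (i : Fin n) (t : Rˣ) :
    logDeriv (dilationGL (single_mul_self i) t) =
      ((t : R)′ * ((t⁻¹ : Rˣ) : R)) • Matrix.single i i 1 := by
  rw [logDeriv, val_dilationGL, val_inv_dilationGL,
    map_deriv_one_add_smul (single_mem_constants_apply i i), map_sub]
  simp only [Derivation.map_one_eq_zero, sub_zero, mul_add, mul_one, smul_mul_assoc,
    mul_smul_comm, single_mul_self]
  module

/-- The subgroup on which a cocycle agrees with `ν` times the logarithmic derivative. -/
def eqLogDerivSubgroup (hf : IsClassicalDeltaCocycle f) (ν : R) : Subgroup (GL (Fin n) R) :=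
  have hmul : ∀ g h : GL (Fin n) R, f (g * h) - ν • logDeriv (g * h) =
      (f g - ν • logDeriv g) + (g : Matrix (Fin n) (Fin n) R) * (f h - ν • logDeriv h) *
        ((g⁻¹ : GL (Fin n) R) : Matrix _ _ R) := fun g h => by
    rw [hf.cocycle, logDeriv_mul]
    simp only [mul_sub, sub_mul, smul_add, mul_smul_comm, smul_mul_assoc]
    abel
  have hone : f 1 - ν • logDeriv 1 = 0 := by simpa using hmul 1 1
  { carrier := {g | f g - ν • logDeriv g = 0}
    one_mem' := hone
    mul_mem' := fun {g h} hg hh => by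
      rw [Set.mem_ofPred_eq] at hg hh ⊢
      rw [hmul, hg, hh]
      simp
    inv_mem' := fun {g} hg => by
      rw [Set.mem_ofPred_eq] at hg ⊢
      have h := hmul g⁻¹ g
      rw [hg, inv_mul_cancel, hone] at h
      simpa using h.symm }

end DeltaAlg

open DeltaAlg in
theorem theorem1p2 {R : Type*} [Field R] [CharZero R] [Differential R]
    (hR : DeltaAlg.IsDeltaClosed R) (n : ℕ) (hn : 2 ≤ n)
    (f : GL (Fin n) R → Matrix (Fin n) (Fin n) R)
    (hf : DeltaAlg.IsClassicalDeltaCocycle f) (hcoh : DeltaAlg.IsDeltaCoherent f) :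
    ∃ ν : R, ∀ g : GL (Fin n) R, f g = ν • DeltaAlg.logDeriv g := by
  obtain ⟨ν, hdil, htrans⟩ := exists_apply_eq_mul_deriv hR hn hf hcoh
  have htop : eqLogDerivSubgroup hf ν = ⊤ := by
    refine eq_top_of_transvectionGL_mem_of_dilationGL_mem (fun i j hij x => sub_eq_zero.2 ?_)
      (fun i t => sub_eq_zero.2 ?_)
    · rw [hcoh.apply_transvectionGL hij, htrans, logDeriv_transvectionGL, smul_smul]
    · rw [hcoh.apply_dilationGL_single, logDeriv_dilationGL_single, smul_smul, ← mul_assoc,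
        ← hdil, mul_assoc, Units.mul_inv, mul_one]
  refine ⟨ν, fun g => sub_eq_zero.1 ?_⟩
  have hg : g ∈ eqLogDerivSubgroup hf ν := htop ▸ Subgroup.mem_top g
  exact hg
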